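/- Let $m,n\ge 0$, $\ell,r,T\ge 1$, $0\le\delta\le\varepsilon$, and let $f_1,\dots,f_T:\mathbb{R}^{m\times n}\to\mathbb{R}$ be convex. Powers of positive semidefinite matrices are taken spectrally, negative powers of singular matrices being powers of the Moore–Penrose pseudoinverse; $\lambda_i(A)$ is the $i$-th largest eigenvalue of $A$, $\|\cdot\|_F$ is the Frobenius norm, and $\partial f$ is the subdifferential for the inner product $\langle A,B\rangle=\mathrm{tr}(A^\top B)$. **FD-update.** Given positive semidefinite $\bar S, M\in\mathbb{R}^{d\times d}$, eigendecompose $\bar S+M=\sum_{i=1}^d\lambda_i u_iu_i^\top$ with $\lambda_1\ge\dots\ge\lambda_d$ and $u_1,\dots,u_d$ orthonormal, and output $\big(\lambda_\ell,\ \sum_{i\le \ell}(\lambda_i-\lambda_\ell)u_iu_i^\top\big)$ (if $\ell>d$, missing eigenvalues and eigenvectors are taken to be $0$). **Sketchy Shampoo** with step size $\eta$. Start from $X_1=0_{m\times n}$, $\bar L_0=0_m$, $\bar R_0=0_n$. For $t=1,\dots,T$: play $X_t$, receive $G_t\in\partial f_t(X_t)$, put $(\rho^L_t,\bar L_t)=\text{FD-update}(\bar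 L_{t-1},G_tG_t^\top)$ and $(\rho^R_t,\bar R_t)=\text{FD-update}(\bar R_{t-1},G_t^\top G_t)$, and $$\tilde L_t=\bar L_t+(\rho^L_{1:t}+\delta)I_m,\qquad \tilde R_t=\bar R_t+(\rho^R_{1:t}+\delta)I_n,\qquad X_{t+1}=X_t-\eta\,\tilde L_t^{-1/4}G_t\tilde R_t^{-1/4},$$ where $\rho_{1:t}=\sum_{s\le t}\rho_s$. (With $\delta=0$ only the escaped mass is compensated; with $\delta=\varepsilon$ the matrix $\varepsilon I$ is kept in the preconditioners throughout.) Let $L=\sum_{t=1}^T G_tG_t^\top$, $R=\sum_{t=1}^T G_t^\top G_t$, $L_T=L+\varepsilon I_m$, $R_T=R+\varepsilon I_n$, and $$\Omega_{L,\ell}=\min_{0\le k\le \ell-1}\frac{\sum_{i=k+1}^m\lambda_i(L)}{\ell-k},\qquad \Omega_{R,\ell}=\min_{0\le k\le \ell-1}\frac{\sum_{i=k+1}^n\lambda_i(R)}{\ell-k}.$$ **Theorem.** Consider a run of Sketchy Shampoo in which every $G_t$ has rank at most $r$. Let $X^*\in\mathbb{R}^{m\times n}$, let $D\ge\max_{1\le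 t\le T}\|X_t-X^*\|_F$ (for instance, $D$ equal to this maximum), and suppose that the step size is $\eta=D/\sqrt{2r}$. Then $$\rho^L_{1:T}\le\Omega_{L,\ell}\le\sum_{i=\ell}^m\lambda_i(L),\qquad \rho^R_{1:T}\le\Omega_{R,\ell}\le\sum_{i=\ell}^n\lambda_i(R),$$ $$\sum_{t=1}^T f_t(X_t)-\sum_{t=1}^T f_t(X^*)\le\sqrt{2r}\,D\,\big(\mathrm{tr}(L_T^{1/4})+m\,\Omega_{L,\ell}^{1/4}\big)\big(\mathrm{tr}(R_T^{1/4})+n\,\Omega_{R,\ell}^{1/4}\big).$$ In particular, if $X^*$ minimizes $\sum_{t=1}^T f_t$ over $\mathbb{R}^{m\times n}$, then $\mathrm{Regret}_T=\sum_{t=1}^T f_t(X_t)-\min_{X}\sum_{t=1}^T f_t(X)$ is at most the right-hand side. -/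

import Mathlib

open scoped Matrix

noncomputable section

namespace SketchyShampoo

/-- The real power `A ^ p` of a symmetric positive semidefinite matrix, obtained by applying
`x ↦ x ^ p` to the eigenvalues. A zero eigenvalue stays zero when `p < 0`, so that negative powers
of a singular matrix are powers of its Moore–Penrose pseudoinverse. -/
def matPow {d : ℕ} (A : Matrix (Fin d) (Fin d) ℝ) (p : ℝ) : Matrix (Fin d) (Fin d) ℝ :=
  cfc (fun x : ℝ => x ^ p) A

/-- The Frobenius norm. -/
def frobNorm {m n : ℕ} (A : Matrix (Fin m) (Fin n) ℝ) : ℝ :=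
  Real.sqrt (∑ i, ∑ j, A i j ^ 2)

open Classical in
/-- `eig A i` is the `i`-th leading eigenvalue (`i = 1, …, d`, with multiplicity) of a symmetric
`d × d` matrix; it is set to `0` for all other `i`. -/
def eig {d : ℕ} (A : Matrix (Fin d) (Fin d) ℝ) (i : ℕ) : ℝ :=
  if hA : A.IsHermitian then
    if hi : 1 ≤ i ∧ i ≤ d then
      hA.eigenvalues₀ ⟨i - 1, by rw [Fintype.card_fin]; omega⟩
    else 0
  else 0

/-- `min_{k = 0, …, ℓ-1} (∑_{i=k+1}^d λ_i(A)) / (ℓ - k)` (for `ℓ ≥ 1`). -/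
def Omega {d : ℕ} (ℓ : ℕ) (A : Matrix (Fin d) (Fin d) ℝ) : ℝ :=
  ⨅ k : Fin ℓ, (∑ i ∈ Finset.Icc ((k : ℕ) + 1) d, eig A i) / ((ℓ : ℝ) - ((k : ℕ) : ℝ))

/-- Extend a finite list of eigenvalues by zeros: the value at the 0-based position `j`. -/
def pad {d : ℕ} (v : Fin d → ℝ) (j : ℕ) : ℝ :=
  if h : j < d then v ⟨j, h⟩ else 0

/-- One Frequent Directions update with sketch size `ℓ ≥ 1`: from the state `Gprev` and the new
positive semidefinite matrix `M` it outputs the removed eigenvalue `ρ` and the new state `Gnew`.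
Here `U` and `lam` form an (arbitrary) eigendecomposition with descending eigenvalues of
`Gprev + M`, `ρ` is the `ℓ`-th eigenvalue, and `B` is the `d × ℓ` matrix whose `j`-th column is the
`j`-th eigenvector times the square root of the `j`-th eigenvalue minus `ρ`. If `ℓ > d`, the missing
eigenvalues and columns are zero. -/
def IsFDUpdate {d : ℕ} (ℓ : ℕ) (Gprev M : Matrix (Fin d) (Fin d) ℝ)
    (ρ : ℝ) (Gnew : Matrix (Fin d) (Fin d) ℝ) : Prop :=
  ∃ (U : Matrix (Fin d) (Fin d) ℝ) (lam : Fin d → ℝ) (B : Matrix (Fin d) (Fin ℓ) ℝ),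
    U * Uᵀ = 1 ∧
    Antitone lam ∧
    Gprev + M = U * Matrix.diagonal lam * Uᵀ ∧
    ρ = pad lam (ℓ - 1) ∧
    (∀ (i : Fin d) (j : Fin ℓ),
      B i j = pad (fun c => U i c) (j : ℕ) * Real.sqrt (pad lam (j : ℕ) - ρ)) ∧
    Gnew = B * Bᵀ

/-- `G ∈ ∂f(X)` for the inner product `⟨A, B⟩ = tr (Aᵀ B)`. -/
def IsSubgradient {m n : ℕ} (f : Matrix (Fin m) (Fin n) ℝ → ℝ)
    (X G : Matrix (Fin m) (Fin n) ℝ) : Prop :=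
  ∀ Y, f X + (Gᵀ * (Y - X)).trace ≤ f Y

/-- The cumulative escaped mass `ρ_{1:t}`. -/
def cumMass (ρ : ℕ → ℝ) (t : ℕ) : ℝ := ∑ s ∈ Finset.Icc 1 t, ρ s

/-- The sketch compensated with the cumulative escaped mass and with the regularization `δ`. -/
def precond {d : ℕ} (δ : ℝ) (Sbar : ℕ → Matrix (Fin d) (Fin d) ℝ) (ρ : ℕ → ℝ) (t : ℕ) :
    Matrix (Fin d) (Fin d) ℝ :=
  Sbar t + (cumMass ρ t + δ) • (1 : Matrix (Fin d) (Fin d) ℝ)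

/-- The sequences form a run of Sketchy Shampoo over the rounds `t = 1, …, T` with sketch size `ℓ`,
step size `η` and regularization `δ`, on the losses `f 1, …, f T`; the first point played is `0`. -/
structure IsRun {m n : ℕ} (ℓ T : ℕ) (η δ : ℝ) (f : ℕ → Matrix (Fin m) (Fin n) ℝ → ℝ)
    (X G : ℕ → Matrix (Fin m) (Fin n) ℝ)
    (Lbar : ℕ → Matrix (Fin m) (Fin m) ℝ) (Rbar : ℕ → Matrix (Fin n) (Fin n) ℝ)
    (ρL ρR : ℕ → ℝ) : Prop where
  X_one : X 1 = 0
  Lbar_zero : Lbar 0 = 0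
  Rbar_zero : Rbar 0 = 0
  subgradient : ∀ t ∈ Finset.Icc 1 T, IsSubgradient (f t) (X t) (G t)
  sketch_left : ∀ t ∈ Finset.Icc 1 T,
    IsFDUpdate ℓ (Lbar (t - 1)) (G t * (G t)ᵀ) (ρL t) (Lbar t)
  sketch_right : ∀ t ∈ Finset.Icc 1 T,
    IsFDUpdate ℓ (Rbar (t - 1)) ((G t)ᵀ * G t) (ρR t) (Rbar t)
  step : ∀ t ∈ Finset.Icc 1 T,
    X (t + 1) = X t - η • (matPow (precond δ Lbar ρL t) (-1 / 4) * G t *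
      matPow (precond δ Rbar ρR t) (-1 / 4))

/-- `∑_{t=1}^T G_t G_tᵀ`. -/
def leftCov {m n : ℕ} (T : ℕ) (G : ℕ → Matrix (Fin m) (Fin n) ℝ) : Matrix (Fin m) (Fin m) ℝ :=
  ∑ t ∈ Finset.Icc 1 T, G t * (G t)ᵀ

/-- `∑_{t=1}^T G_tᵀ G_t`. -/
def rightCov {m n : ℕ} (T : ℕ) (G : ℕ → Matrix (Fin m) (Fin n) ℝ) : Matrix (Fin n) (Fin n) ℝ :=
  ∑ t ∈ Finset.Icc 1 T, (G t)ᵀ * G t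

/-- `∑_{t=1}^T f_t(X_t) - inf_Y ∑_{t=1}^T f_t(Y)`. It is used only where the infimum is a minimum. -/
def regret {m n : ℕ} (T : ℕ) (f : ℕ → Matrix (Fin m) (Fin n) ℝ → ℝ)
    (X : ℕ → Matrix (Fin m) (Fin n) ℝ) : ℝ :=
  ∑ t ∈ Finset.Icc 1 T, f t (X t) - ⨅ Y, ∑ t ∈ Finset.Icc 1 T, f t Y

/-- The right-hand side
`√(2r) D (tr L_T^{1/4} + m Ω_L^{1/4}) (tr R_T^{1/4} + n Ω_R^{1/4})`. -/
def regretBound {m n : ℕ} (ℓ r T : ℕ) (D ε : ℝ) (G : ℕ → Matrix (Fin m) (Fin n) ℝ) : ℝ :=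
  Real.sqrt (2 * (r : ℝ)) * D *
    ((matPow (leftCov T G + ε • (1 : Matrix (Fin m) (Fin m) ℝ)) (1 / 4)).trace +
      (m : ℝ) * Omega ℓ (leftCov T G) ^ (1 / 4 : ℝ)) *
    ((matPow (rightCov T G + ε • (1 : Matrix (Fin n) (Fin n) ℝ)) (1 / 4)).trace +
      (n : ℝ) * Omega ℓ (rightCov T G) ^ (1 / 4 : ℝ))

end SketchyShampoo

end

/-! The run is online mirror descent in the norms `weightedSq` with weights `L̃_t^{1/4}`,
`R̃_t^{1/4}`, and its potential is `τ_t = tr L̃_t^{1/4} · tr R̃_t^{1/4}`, the trace of the Kronecker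
product of the weights. Expanding the square of one step (`weightedSq_step`) leaves two costs.
Replacing the old norm by the new one costs at most `D² (τ_t - τ_{t-1})` (`weightedSq_sub_le`), and
the gradient term costs at most `2η² (τ_t - τ_{t-1})` (`weightedSq_gradient_le`). Both telescope, so
`2η` times the linearized regret is at most `(D² + 2η²) τ_T`.

The sketch enters this argument only through `L̃_t ⪰ L̃_{t-1} + G_t G_tᵀ` and its right analogue: an
update lowers no eigenvalue by more than `ρ_t`, and the compensation restores `ρ_t`. It remains to
bound `τ_T`. Here `L̃_T ⪯ L_T + ρ_{1:T} I`, and the fourth root is operator monotone and subadditive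
on scalars. Finally `ρ_{1:T} ≤ Ω`, because each update removes trace at least `ℓ ρ_t` while the
compensated sketch still dominates `L` (`sum_eig_tail_ge`). -/

open scoped Matrix

namespace SketchyShampoo

open Matrix

variable {d m n : ℕ}

/-! ### Orthogonal changes of basis, diagonal entries and traces. -/

section Conjugation

theorem posSemidef_transpose_conj {A : Matrix (Fin d) (Fin d) ℝ} (hA : A.PosSemidef)
    (U : Matrix (Fin d) (Fin n) ℝ) : (Uᵀ * A * U).PosSemidef := by
  simpa using hA.conjTranspose_mul_mul_same U

theorem posSemidef_conj_diagonal (U : Matrix (Fin d) (Fin n) ℝ) {a : Fin n → ℝ}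
    (ha : ∀ i, 0 ≤ a i) : (U * diagonal a * Uᵀ).PosSemidef := by
  simpa using (PosSemidef.diagonal (d := a) ha).mul_mul_conjTranspose_same U

theorem posSemidef_mul_transpose_self (X : Matrix (Fin m) (Fin n) ℝ) : (X * Xᵀ).PosSemidef := by
  simpa using posSemidef_self_mul_conjTranspose X

theorem posSemidef_transpose_mul_self (X : Matrix (Fin m) (Fin n) ℝ) : (Xᵀ * X).PosSemidef := by
  simpa using posSemidef_conjTranspose_mul_self X

theorem diag_conj_le {A B : Matrix (Fin d) (Fin d) ℝ} (h : (B - A).PosSemidef)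
    (U : Matrix (Fin d) (Fin n) ℝ) (i : Fin n) : (Uᵀ * A * U) i i ≤ (Uᵀ * B * U) i i := by
  have := (posSemidef_transpose_conj h U).diag_nonneg (i := i)
  rw [Matrix.mul_sub, Matrix.sub_mul, Matrix.sub_apply] at this
  linarith

theorem trace_transpose_conj {U : Matrix (Fin d) (Fin d) ℝ} (hU : U * Uᵀ = 1)
    (A : Matrix (Fin d) (Fin d) ℝ) : (Uᵀ * A * U).trace = A.trace := by
  rw [trace_mul_cycle, hU, Matrix.one_mul]

theorem transpose_conj_conj {U : Matrix (Fin d) (Fin d) ℝ} (hU : Uᵀ * U = 1)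
    (A : Matrix (Fin d) (Fin d) ℝ) : Uᵀ * (U * A * Uᵀ) * U = A := by
  calc Uᵀ * (U * A * Uᵀ) * U = (Uᵀ * U) * A * (Uᵀ * U) := by simp only [Matrix.mul_assoc]
    _ = A := by rw [hU, Matrix.one_mul, Matrix.mul_one]

theorem conj_mul_conj {U : Matrix (Fin d) (Fin d) ℝ} (hU : Uᵀ * U = 1)
    (A B : Matrix (Fin d) (Fin d) ℝ) : (U * A * Uᵀ) * (U * B * Uᵀ) = U * (A * B) * Uᵀ := by
  calc (U * A * Uᵀ) * (U * B * Uᵀ) = U * A * (Uᵀ * U) * B * Uᵀ := by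
        simp only [Matrix.mul_assoc]
    _ = U * (A * B) * Uᵀ := by rw [hU, Matrix.mul_one]; simp only [Matrix.mul_assoc]

theorem trace_conj_diagonal {U : Matrix (Fin d) (Fin d) ℝ} (hU : Uᵀ * U = 1) (a : Fin d → ℝ) :
    (U * diagonal a * Uᵀ).trace = ∑ i, a i := by
  rw [trace_mul_cycle, hU, Matrix.one_mul, trace_diagonal]

theorem sq_apply_le_mul_transpose (X : Matrix (Fin m) (Fin n) ℝ) (i : Fin m) (j : Fin n) :
    X i j ^ 2 ≤ (X * Xᵀ) i i := by
  rw [Matrix.mul_apply]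
  simp only [transpose_apply, ← sq]
  exact Finset.single_le_sum (f := fun j => X i j ^ 2) (fun _ _ => sq_nonneg _)
    (Finset.mem_univ j)

/-- The diagonal form of the operator Jensen inequality for the square. -/
theorem sq_diag_conj_le {U : Matrix (Fin d) (Fin d) ℝ} (hU : U * Uᵀ = 1)
    {A : Matrix (Fin d) (Fin d) ℝ} (hA : A.PosSemidef) (i : Fin d) :
    (Uᵀ * A * U) i i ^ 2 ≤ (Uᵀ * (A * A) * U) i i := by
  have hT : Aᵀ = A := by simpa using hA.isHermitian.eq
  have h : (Uᵀ * A * U) * (Uᵀ * A * U)ᵀ = Uᵀ * (A * A) * U := by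
    simp only [transpose_mul, transpose_transpose, hT]
    calc Uᵀ * A * U * (Uᵀ * (A * U)) = Uᵀ * A * (U * Uᵀ) * A * U := by
          simp only [Matrix.mul_assoc]
      _ = _ := by rw [hU, Matrix.mul_one]; simp only [Matrix.mul_assoc]
  rw [← h]
  exact sq_apply_le_mul_transpose _ i i

theorem trace_transpose_mul (X Y : Matrix (Fin m) (Fin n) ℝ) :
    (Xᵀ * Y).trace = ∑ i, ∑ j, X i j * Y i j := by
  rw [Finset.sum_comm]
  simp [trace, Matrix.mul_apply]

/-- This diagonalizes the Kronecker-weighted quadratic form, so that matrix estimates reduce to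
scalar ones for each pair `(i, j)`. -/
theorem trace_quad_diagonal (X : Matrix (Fin m) (Fin n) ℝ) (U : Matrix (Fin m) (Fin m) ℝ)
    (W : Matrix (Fin n) (Fin n) ℝ) (a : Fin m → ℝ) (b : Fin n → ℝ) :
    (Xᵀ * (U * diagonal a * Uᵀ) * X * (W * diagonal b * Wᵀ)).trace =
      ∑ i, ∑ j, a i * b j * (Uᵀ * X * W) i j ^ 2 := by
  have h : (Xᵀ * (U * diagonal a * Uᵀ) * X * (W * diagonal b * Wᵀ)).trace =
      ((Uᵀ * X * W)ᵀ * (diagonal a * (Uᵀ * X * W) * diagonal b)).trace := by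
    rw [← Matrix.mul_assoc, trace_mul_comm]
    congr 1
    simp only [transpose_mul, transpose_transpose, Matrix.mul_assoc]
  rw [h, trace_transpose_mul]
  refine Finset.sum_congr rfl fun i _ => Finset.sum_congr rfl fun j _ => ?_
  rw [mul_diagonal, diagonal_mul]
  ring

theorem trace_transpose_mul_conj {U : Matrix (Fin m) (Fin m) ℝ} {W : Matrix (Fin n) (Fin n) ℝ}
    (hU : U * Uᵀ = 1) (hW : W * Wᵀ = 1) (X Y : Matrix (Fin m) (Fin n) ℝ) :
    (Xᵀ * Y).trace = ∑ i, ∑ j, (Uᵀ * X * W) i j * (Uᵀ * Y * W) i j := by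
  rw [← trace_transpose_mul]
  calc (Xᵀ * Y).trace = (W * Wᵀ * (Xᵀ * (U * Uᵀ) * Y)).trace := by
        rw [hU, hW, Matrix.mul_one, Matrix.one_mul]
    _ = (Wᵀ * (Xᵀ * (U * Uᵀ) * Y) * W).trace := by
        rw [Matrix.mul_assoc, trace_mul_comm]
    _ = _ := by
        congr 1
        simp only [transpose_mul, transpose_transpose, Matrix.mul_assoc]

theorem frobNorm_sq (X : Matrix (Fin m) (Fin n) ℝ) : frobNorm X ^ 2 = (Xᵀ * X).trace := by
  rw [trace_transpose_mul, frobNorm, Real.sq_sqrt]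
  · simp only [sq]
  · positivity

theorem frobNorm_nonneg (X : Matrix (Fin m) (Fin n) ℝ) : 0 ≤ frobNorm X := Real.sqrt_nonneg _

theorem eq_zero_of_frobNorm_le_zero {X : Matrix (Fin m) (Fin n) ℝ} (h : frobNorm X ≤ 0) :
    X = 0 := by
  have h2 : (Xᵀ * X).trace = 0 := by
    rw [← frobNorm_sq, le_antisymm h (frobNorm_nonneg X)]; simp
  simpa using trace_conjTranspose_mul_self_eq_zero_iff (A := X) |>.1 (by simpa using h2)

end Conjugation

/-! ### Spectral powers and operator monotonicity of the fourth root. -/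

section Spectral

/-- Spectral decomposition of a symmetric matrix, with the functional calculus of its shifts. -/
theorem exists_spectral {A : Matrix (Fin d) (Fin d) ℝ} (hA : A.IsHermitian) :
    ∃ U : Matrix (Fin d) (Fin d) ℝ, U * Uᵀ = 1 ∧ Uᵀ * U = 1 ∧
      A = U * diagonal hA.eigenvalues * Uᵀ ∧
      ∀ (f : ℝ → ℝ) (c : ℝ), cfc f (A + c • (1 : Matrix (Fin d) (Fin d) ℝ)) =
        U * diagonal (fun i => f (hA.eigenvalues i + c)) * Uᵀ := by
  have hs : ∀ U : Matrix (Fin d) (Fin d) ℝ, star U = Uᵀ := fun U => by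
    rw [star_eq_conjTranspose, conjTranspose_eq_transpose_of_trivial]
  have hcfc : ∀ f : ℝ → ℝ, cfc f A = (hA.eigenvectorUnitary : Matrix (Fin d) (Fin d) ℝ) *
      diagonal (fun i => f (hA.eigenvalues i)) *
      (hA.eigenvectorUnitary : Matrix (Fin d) (Fin d) ℝ)ᵀ := fun f => by
    rw [hA.cfc_eq, IsHermitian.cfc, Unitary.conjStarAlgAut_apply, ← hs]
    rfl
  refine ⟨hA.eigenvectorUnitary, ?_, ?_, ?_, fun f c => ?_⟩
  · rw [← hs]; exact Unitary.coe_mul_star_self _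
  · rw [← hs]; exact Unitary.coe_star_mul_self _
  · conv_lhs => rw [hA.spectral_theorem, Unitary.conjStarAlgAut_apply]
    rw [← hs]
    rfl
  -- The spectrum is finite, so every function is continuous on it, including negative powers at
  -- `0`.
  · have hfin : (spectrum ℝ A).Finite := A.finite_real_spectrum
    have hsa : IsSelfAdjoint A := hA
    have hshift := cfc_add_const c (fun x : ℝ => x) A (hfin.continuousOn _) hsa
    have hcomp := cfc_comp f (fun x : ℝ => x + c) A hsa ((hfin.image _).continuousOn _)
      (hfin.continuousOn _)
    rw [cfc_id' ℝ A hsa, Algebra.algebraMap_eq_smul_one] at hshift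
    rw [← hshift, ← hcomp, hcfc]
    rfl

theorem exists_spectral_matPow {A : Matrix (Fin d) (Fin d) ℝ} (hA : A.PosSemidef) :
    ∃ (U : Matrix (Fin d) (Fin d) ℝ) (a : Fin d → ℝ), U * Uᵀ = 1 ∧ Uᵀ * U = 1 ∧ (∀ i, 0 ≤ a i) ∧
      A = U * diagonal a * Uᵀ ∧ ∀ p : ℝ, matPow A p = U * diagonal (fun i => a i ^ p) * Uᵀ := by
  obtain ⟨U, h1, h2, h3, h4⟩ := exists_spectral hA.isHermitian
  refine ⟨U, _, h1, h2, hA.eigenvalues_nonneg, h3, fun p => ?_⟩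
  simpa [matPow] using h4 (fun x => x ^ p) 0

theorem posSemidef_matPow {A : Matrix (Fin d) (Fin d) ℝ} (hA : A.PosSemidef) (p : ℝ) :
    (matPow A p).PosSemidef := by
  obtain ⟨U, a, -, -, ha, -, h⟩ := exists_spectral_matPow hA
  rw [h]
  exact posSemidef_conj_diagonal U fun i => Real.rpow_nonneg (ha i) p

theorem matPow_one {A : Matrix (Fin d) (Fin d) ℝ} (hA : A.PosSemidef) : matPow A 1 = A := by
  obtain ⟨U, a, -, -, ha, hA', h⟩ := exists_spectral_matPow hA
  rw [h]
  simpa using hA'.symm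

theorem matPow_half_mul_self {A : Matrix (Fin d) (Fin d) ℝ} (hA : A.PosSemidef) {p : ℝ}
    (hp : 0 < p) : matPow A (p / 2) * matPow A (p / 2) = matPow A p := by
  obtain ⟨U, a, -, hU, ha, -, h⟩ := exists_spectral_matPow hA
  rw [h, h, conj_mul_conj hU, diagonal_mul_diagonal]
  congr! 3
  ext i
  rw [← Real.rpow_add_of_nonneg (ha i) (by positivity) (by positivity), add_halves]

/-- The square root is operator monotone. -/
theorem posSemidef_sub_of_sq {P Q : Matrix (Fin d) (Fin d) ℝ} (hP : P.PosSemidef)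
    (hQ : Q.PosSemidef) (h : (Q * Q - P * P).PosSemidef) : (Q - P).PosSemidef := by
  have hH : (Q - P).IsHermitian := hQ.isHermitian.sub hP.isHermitian
  obtain ⟨U, hU, hU', hD, -⟩ := exists_spectral hH
  set μ := hH.eigenvalues
  have hD' : Uᵀ * (Q - P) * U = diagonal μ := by
    rw [hD]; exact transpose_conj_conj hU' _
  -- For a unit eigenvector `v` of `Q - P` with eigenvalue `μ < 0`, the identity `Q² - P² = Q(Q - P)
  -- + (Q - P)P` gives `0 ≤ μ (⟨v, Qv⟩ + ⟨v, Pv⟩)`. Hence both terms vanish, against `⟨v, Qv⟩ - ⟨v,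
  -- Pv⟩ = μ`.
  have hμ : ∀ i, 0 ≤ μ i := by
    intro i
    by_contra! hneg
    have h1 : (Uᵀ * (Q * Q - P * P) * U) i i =
        μ i * ((Uᵀ * Q * U) i i + (Uᵀ * P * U) i i) := by
      have : Uᵀ * (Q * Q - P * P) * U =
          (Uᵀ * Q * U) * (Uᵀ * (Q - P) * U) + (Uᵀ * (Q - P) * U) * (Uᵀ * P * U) := by
        calc Uᵀ * (Q * Q - P * P) * U = Uᵀ * (Q * 1 * (Q - P) + (Q - P) * 1 * P) * U := by
              congr 2; noncomm_ring
          _ = _ := by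
              rw [← hU]
              simp only [Matrix.mul_add, Matrix.add_mul, Matrix.mul_assoc]
      rw [this, hD', Matrix.add_apply, mul_diagonal, diagonal_mul]
      ring
    have h2 : (Uᵀ * Q * U) i i - (Uᵀ * P * U) i i = μ i := by
      rw [← Matrix.sub_apply, ← Matrix.sub_mul, ← Matrix.mul_sub, hD', diagonal_apply_eq]
    have h3 := (posSemidef_transpose_conj h U).diag_nonneg (i := i)
    have h4 := (posSemidef_transpose_conj hP U).diag_nonneg (i := i)
    have h5 := (posSemidef_transpose_conj hQ U).diag_nonneg (i := i)
    rw [h1] at h3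
    nlinarith
  rw [hD]
  exact posSemidef_conj_diagonal U hμ

theorem posSemidef_matPow_half_sub {A B : Matrix (Fin d) (Fin d) ℝ} (hA : A.PosSemidef)
    (hB : B.PosSemidef) {p : ℝ} (hp : 0 < p) (h : (matPow B p - matPow A p).PosSemidef) :
    (matPow B (p / 2) - matPow A (p / 2)).PosSemidef := by
  refine posSemidef_sub_of_sq (posSemidef_matPow hA _) (posSemidef_matPow hB _) ?_
  rwa [matPow_half_mul_self hA hp, matPow_half_mul_self hB hp]

/-- The fourth root is operator monotone. -/
theorem posSemidef_matPow_quarter_sub {A B : Matrix (Fin d) (Fin d) ℝ} (hA : A.PosSemidef)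
    (hB : B.PosSemidef) (h : (B - A).PosSemidef) :
    (matPow B (1 / 4) - matPow A (1 / 4)).PosSemidef := by
  rw [← matPow_one hA, ← matPow_one hB] at h
  rw [show (1 / 4 : ℝ) = 1 / 2 / 2 by norm_num]
  exact posSemidef_matPow_half_sub hA hB (by norm_num)
    (posSemidef_matPow_half_sub hA hB (by norm_num) h)

/-- Jensen for the square, applied twice: to the fourth root and then to the square root. -/
theorem diag_conj_matPow_quarter_pow_le {U : Matrix (Fin d) (Fin d) ℝ} (hU : U * Uᵀ = 1)
    {A : Matrix (Fin d) (Fin d) ℝ} (hA : A.PosSemidef) (i : Fin d) :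
    (Uᵀ * matPow A (1 / 4) * U) i i ^ 4 ≤ (Uᵀ * A * U) i i := by
  have h1 := sq_diag_conj_le hU (posSemidef_matPow hA (1 / 2 / 2)) i
  have h2 := sq_diag_conj_le hU (posSemidef_matPow hA (1 / 2)) i
  rw [matPow_half_mul_self hA (by norm_num)] at h1
  rw [matPow_half_mul_self hA (by norm_num), matPow_one hA] at h2
  rw [show (1 / 4 : ℝ) = 1 / 2 / 2 by norm_num]
  calc _ = ((Uᵀ * matPow A (1 / 2 / 2) * U) i i ^ 2) ^ 2 := by ring
    _ ≤ _ := (pow_le_pow_left₀ (sq_nonneg _) h1 2).trans h2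

end Spectral

/-! ### One preconditioned step: expansion, change of norm, gradient term. -/

section OneStep

/-- The squared norm of `X` weighted by the Kronecker product of `A` and `B`. -/
def weightedSq (A : Matrix (Fin m) (Fin m) ℝ) (B : Matrix (Fin n) (Fin n) ℝ)
    (X : Matrix (Fin m) (Fin n) ℝ) : ℝ :=
  (Xᵀ * A * X * B).trace

theorem weightedSq_nonneg {A : Matrix (Fin m) (Fin m) ℝ} {B : Matrix (Fin n) (Fin n) ℝ}
    (hA : A.PosSemidef) (hB : B.PosSemidef) (X : Matrix (Fin m) (Fin n) ℝ) :
    0 ≤ weightedSq A B X := by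
  obtain ⟨U, hU, hU', hA', -⟩ := exists_spectral hA.isHermitian
  obtain ⟨W, hW, hW', hB', -⟩ := exists_spectral hB.isHermitian
  rw [weightedSq, hA', hB', trace_quad_diagonal]
  exact Finset.sum_nonneg fun i _ => Finset.sum_nonneg fun j _ =>
    mul_nonneg (mul_nonneg (hA.eigenvalues_nonneg i) (hB.eigenvalues_nonneg j)) (sq_nonneg _)

/-- In eigenbases of `A` and `B` every squared entry of the rotated `X` is at most `‖X‖_F²`. Passing
to traces is lossy, but traces are additive and therefore telescope. -/
theorem weightedSq_le {A : Matrix (Fin m) (Fin m) ℝ} {B : Matrix (Fin n) (Fin n) ℝ}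
    (hA : A.PosSemidef) (hB : B.PosSemidef) (X : Matrix (Fin m) (Fin n) ℝ) :
    weightedSq A B X ≤ frobNorm X ^ 2 * (A.trace * B.trace) := by
  obtain ⟨U, hU, hU', hA', -⟩ := exists_spectral hA.isHermitian
  obtain ⟨W, hW, hW', hB', -⟩ := exists_spectral hB.isHermitian
  have hent : ∀ i j, (Uᵀ * X * W) i j ^ 2 ≤ frobNorm X ^ 2 := fun i j => by
    rw [frobNorm_sq, trace_transpose_mul_conj hU hW]
    calc (Uᵀ * X * W) i j ^ 2 ≤ ∑ j, (Uᵀ * X * W) i j ^ 2 :=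
          Finset.single_le_sum (f := fun j => (Uᵀ * X * W) i j ^ 2) (fun _ _ => sq_nonneg _)
            (Finset.mem_univ j)
      _ ≤ ∑ i, ∑ j, (Uᵀ * X * W) i j ^ 2 :=
          Finset.single_le_sum (f := fun i => ∑ j, (Uᵀ * X * W) i j ^ 2)
            (fun _ _ => Finset.sum_nonneg fun _ _ => sq_nonneg _) (Finset.mem_univ i)
      _ = _ := by simp only [sq]
  have htA : A.trace = ∑ i, hA.isHermitian.eigenvalues i := by
    conv_lhs => rw [hA', trace_conj_diagonal hU']
  have htB : B.trace = ∑ i, hB.isHermitian.eigenvalues i := by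
    conv_lhs => rw [hB', trace_conj_diagonal hW']
  rw [htA, htB, weightedSq]
  conv_lhs => rw [hA', hB', trace_quad_diagonal]
  rw [Finset.sum_mul_sum, Finset.mul_sum]
  refine Finset.sum_le_sum fun i _ => ?_
  rw [Finset.mul_sum]
  refine Finset.sum_le_sum fun j _ => ?_
  rw [mul_comm (frobNorm X ^ 2)]
  exact mul_le_mul_of_nonneg_left (hent i j)
    (mul_nonneg (hA.eigenvalues_nonneg i) (hB.eigenvalues_nonneg j))

/-- Changing the weights of `weightedSq` monotonically costs at most the change of the traces. -/
theorem weightedSq_sub_le {A A' : Matrix (Fin m) (Fin m) ℝ} {B B' : Matrix (Fin n) (Fin n) ℝ}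
    (hA' : A'.PosSemidef) (hB : B.PosSemidef) (hA : (A - A').PosSemidef)
    (hB' : (B - B').PosSemidef) (X : Matrix (Fin m) (Fin n) ℝ) :
    weightedSq A B X - weightedSq A' B' X ≤
      frobNorm X ^ 2 * (A.trace * B.trace - A'.trace * B'.trace) := by
  -- `A ⊗ B - A' ⊗ B' = (A - A') ⊗ B + A' ⊗ (B - B')`, with positive semidefinite factors
  -- throughout.
  have h1 := weightedSq_le hA hB X
  have h2 := weightedSq_le hA' hB' X
  simp only [weightedSq, Matrix.mul_sub, Matrix.sub_mul, trace_sub] at h1 h2 ⊢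
  linarith

theorem sq_conj_apply_le_left {W : Matrix (Fin n) (Fin n) ℝ} (hW : W * Wᵀ = 1)
    (U : Matrix (Fin m) (Fin m) ℝ) (G : Matrix (Fin m) (Fin n) ℝ) (i : Fin m) (j : Fin n) :
    (Uᵀ * G * W) i j ^ 2 ≤ (Uᵀ * (G * Gᵀ) * U) i i := by
  have h : (Uᵀ * G * W) * (Uᵀ * G * W)ᵀ = Uᵀ * (G * Gᵀ) * U := by
    simp only [transpose_mul, transpose_transpose]
    calc Uᵀ * G * W * (Wᵀ * (Gᵀ * U)) = Uᵀ * G * (W * Wᵀ) * Gᵀ * U := by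
          simp only [Matrix.mul_assoc]
      _ = _ := by rw [hW, Matrix.mul_one]; simp only [Matrix.mul_assoc]
  rw [← h]
  exact sq_apply_le_mul_transpose _ i j

theorem sq_conj_apply_le_right {U : Matrix (Fin m) (Fin m) ℝ} (hU : U * Uᵀ = 1)
    (W : Matrix (Fin n) (Fin n) ℝ) (G : Matrix (Fin m) (Fin n) ℝ) (i : Fin m) (j : Fin n) :
    (Uᵀ * G * W) i j ^ 2 ≤ (Wᵀ * (Gᵀ * G) * W) j j := by
  have h := sq_conj_apply_le_left hU W Gᵀ j i
  rwa [transpose_transpose, show (Wᵀ * Gᵀ * U) j i = (Uᵀ * G * W) i j by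
    rw [← transpose_apply (Wᵀ * Gᵀ * U)]
    simp only [transpose_mul, transpose_transpose, Matrix.mul_assoc]] at h

/-- With `s = a^{1/4}` and `t = b^{1/4}`, Cauchy–Schwarz for `(α², √k)` and `(β², √k)` gives `k ≤
(st)² - (αβ)²`. The right side is at most `2st(st - αβ)`, the difference being `(st - αβ)²`; then
divide by `st`. -/
theorem rpow_neg_quarter_mul_le {a b α β k : ℝ} (hk : 0 ≤ k)
    (ha : α ^ 4 + k ≤ a) (hb : β ^ 4 + k ≤ b) :
    a ^ (-1 / 4 : ℝ) * b ^ (-1 / 4 : ℝ) * k ≤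
      2 * (a ^ (1 / 4 : ℝ) * b ^ (1 / 4 : ℝ) - α * β) := by
  have ha0 : 0 ≤ a := le_trans (by positivity) ha
  have hb0 : 0 ≤ b := le_trans (by positivity) hb
  set s := a ^ (1 / 4 : ℝ) with hs
  set t := b ^ (1 / 4 : ℝ) with ht
  have hs0 : 0 ≤ s := Real.rpow_nonneg ha0 _
  have ht0 : 0 ≤ t := Real.rpow_nonneg hb0 _
  have hs4 : s ^ 4 = a := by
    rw [hs, ← Real.rpow_natCast, ← Real.rpow_mul ha0]; norm_num
  have ht4 : t ^ 4 = b := by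
    rw [ht, ← Real.rpow_natCast, ← Real.rpow_mul hb0]; norm_num
  have hsi : a ^ (-1 / 4 : ℝ) = s⁻¹ := by rw [hs, ← Real.rpow_neg ha0]; norm_num
  have hti : b ^ (-1 / 4 : ℝ) = t⁻¹ := by rw [ht, ← Real.rpow_neg hb0]; norm_num
  rw [hsi, hti]
  rw [← hs4] at ha
  rw [← ht4] at hb
  have h1 : k + (α * β) ^ 2 ≤ (s * t) ^ 2 := by
    refine le_of_sq_le_sq ?_ (by positivity)
    calc (k + (α * β) ^ 2) ^ 2 ≤ (α ^ 4 + k) * (β ^ 4 + k) := by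
          nlinarith [mul_nonneg hk (sq_nonneg (α ^ 2 - β ^ 2))]
      _ ≤ s ^ 4 * t ^ 4 := by gcongr
      _ = _ := by ring
  have hle : α * β ≤ s * t :=
    abs_le_of_sq_le_sq' (by linarith) (by positivity) |>.2
  -- If `st = 0`, the pseudoinverse convention makes the left side zero.
  rcases eq_or_lt_of_le (mul_nonneg hs0 ht0) with h0 | hpos
  · rw [← mul_inv, ← h0]
    simp only [_root_.inv_zero, zero_mul]
    rw [← h0] at hle
    linarith
  · rw [← mul_inv, inv_mul_le_iff₀ hpos]
    nlinarith [sq_nonneg (s * t - α * β)]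

/-- The squared gradient, weighted by the inverse preconditioners, is controlled by the increase of
the trace of the Kronecker product of the preconditioners. -/
theorem weightedSq_gradient_le {L L' : Matrix (Fin m) (Fin m) ℝ} {R R' : Matrix (Fin n) (Fin n) ℝ}
    {G : Matrix (Fin m) (Fin n) ℝ} (hL' : L'.PosSemidef) (hR' : R'.PosSemidef)
    (hL : L.PosSemidef) (hR : R.PosSemidef)
    (hLL : (L - (L' + G * Gᵀ)).PosSemidef) (hRR : (R - (R' + Gᵀ * G)).PosSemidef) :
    weightedSq (matPow L (-1 / 4)) (matPow R (-1 / 4)) G ≤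
      2 * ((matPow L (1 / 4)).trace * (matPow R (1 / 4)).trace -
        (matPow L' (1 / 4)).trace * (matPow R' (1 / 4)).trace) := by
  obtain ⟨U, a, hU, hU', ha, hLU, hLp⟩ := exists_spectral_matPow hL
  obtain ⟨W, b, hW, hW', hb, hRW, hRp⟩ := exists_spectral_matPow hR
  rw [weightedSq, hLp, hRp, trace_quad_diagonal, hLp, hRp, trace_conj_diagonal hU',
    trace_conj_diagonal hW', ← trace_transpose_conj hU (matPow L' (1 / 4)),
    ← trace_transpose_conj hW (matPow R' (1 / 4)), trace, trace, Finset.sum_mul_sum,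
    Finset.sum_mul_sum, ← Finset.sum_sub_distrib, Finset.mul_sum]
  refine Finset.sum_le_sum fun i _ => ?_
  rw [← Finset.sum_sub_distrib, Finset.mul_sum]
  refine Finset.sum_le_sum fun j _ => ?_
  -- Here `k` is the squared `(i, j)` entry of the rotated gradient, and `α`, `β` are the diagonal
  -- entries of the old fourth roots in the new eigenbases.
  refine rpow_neg_quarter_mul_le (sq_nonneg _) ?_ ?_
  · have h1 := diag_conj_le hLL U i
    have h2 := sq_conj_apply_le_left hW U G i j
    have h4 := diag_conj_matPow_quarter_pow_le hU hL' i
    rw [hLU, transpose_conj_conj hU', diagonal_apply_eq, Matrix.mul_add, Matrix.add_mul,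
      Matrix.add_apply] at h1
    simp only [diag_apply]
    linarith
  · have h1 := diag_conj_le hRR W j
    have h2 := sq_conj_apply_le_right hU W G i j
    have h4 := diag_conj_matPow_quarter_pow_le hW hR' j
    rw [hRW, transpose_conj_conj hW', diagonal_apply_eq, Matrix.mul_add, Matrix.add_mul,
      Matrix.add_apply] at h1
    simp only [diag_apply]
    linarith

/-- A nonzero gradient entry `k` forces `a, b > 0`, so the powers cancel; if `k = 0`, the coordinate
does not move. -/
theorem rpow_quarter_step {a b η z k : ℝ} (ha : 0 ≤ a) (hb : 0 ≤ b) (hka : k ^ 2 ≤ a)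
    (hkb : k ^ 2 ≤ b) :
    a ^ (1 / 4 : ℝ) * b ^ (1 / 4 : ℝ) *
        (z - η * (a ^ (-1 / 4 : ℝ) * k * b ^ (-1 / 4 : ℝ))) ^ 2 =
      a ^ (1 / 4 : ℝ) * b ^ (1 / 4 : ℝ) * z ^ 2 - 2 * η * (k * z) +
        η ^ 2 * (a ^ (-1 / 4 : ℝ) * b ^ (-1 / 4 : ℝ) * k ^ 2) := by
  by_cases hk : k = 0
  · simp [hk]
  have hk2 : 0 < k ^ 2 := by positivity
  have ha' : 0 < a ^ (1 / 4 : ℝ) := Real.rpow_pos_of_pos (hk2.trans_le hka) _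
  have hb' : 0 < b ^ (1 / 4 : ℝ) := Real.rpow_pos_of_pos (hk2.trans_le hkb) _
  rw [show (-1 / 4 : ℝ) = -(1 / 4) by norm_num, Real.rpow_neg ha, Real.rpow_neg hb]
  field_simp
  ring

/-- The expansion of one preconditioned step; no range is lost to the pseudoinverses because the
preconditioners dominate `G * Gᵀ` and `Gᵀ * G`. -/
theorem weightedSq_step {L : Matrix (Fin m) (Fin m) ℝ} {R : Matrix (Fin n) (Fin n) ℝ}
    {G : Matrix (Fin m) (Fin n) ℝ} (hL : L.PosSemidef) (hR : R.PosSemidef)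
    (hLG : (L - G * Gᵀ).PosSemidef) (hRG : (R - Gᵀ * G).PosSemidef)
    (Y : Matrix (Fin m) (Fin n) ℝ) (η : ℝ) :
    weightedSq (matPow L (1 / 4)) (matPow R (1 / 4))
        (Y - η • (matPow L (-1 / 4) * G * matPow R (-1 / 4))) =
      weightedSq (matPow L (1 / 4)) (matPow R (1 / 4)) Y - 2 * η * (Gᵀ * Y).trace +
        η ^ 2 * weightedSq (matPow L (-1 / 4)) (matPow R (-1 / 4)) G := by
  obtain ⟨U, a, hU, hU', ha, hLU, hLp⟩ := exists_spectral_matPow hL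
  obtain ⟨W, b, hW, hW', hb, hRW, hRp⟩ := exists_spectral_matPow hR
  have hka : ∀ i j, (Uᵀ * G * W) i j ^ 2 ≤ a i := fun i j => by
    have h1 := diag_conj_le hLG U i
    have h2 := sq_conj_apply_le_left hW U G i j
    rw [hLU, transpose_conj_conj hU', diagonal_apply_eq] at h1
    exact h2.trans h1
  have hkb : ∀ i j, (Uᵀ * G * W) i j ^ 2 ≤ b j := fun i j => by
    have h1 := diag_conj_le hRG W j
    have h2 := sq_conj_apply_le_right hU W G i j
    rw [hRW, transpose_conj_conj hW', diagonal_apply_eq] at h1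
    exact h2.trans h1
  have hent : ∀ i j, (Uᵀ * (Y - η • (matPow L (-1 / 4) * G * matPow R (-1 / 4))) * W) i j =
      (Uᵀ * Y * W) i j -
        η * (a i ^ (-1 / 4 : ℝ) * (Uᵀ * G * W) i j * b j ^ (-1 / 4 : ℝ)) := fun i j => by
    have : Uᵀ * (matPow L (-1 / 4) * G * matPow R (-1 / 4)) * W =
        diagonal (fun i => a i ^ (-1 / 4 : ℝ)) * (Uᵀ * G * W) *
          diagonal (fun j => b j ^ (-1 / 4 : ℝ)) := by
      rw [hLp, hRp]
      calc _ = (Uᵀ * U) * diagonal (fun i => a i ^ (-1 / 4 : ℝ)) * (Uᵀ * G * W) *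
            diagonal (fun j => b j ^ (-1 / 4 : ℝ)) * (Wᵀ * W) := by
              simp only [Matrix.mul_assoc]
        _ = _ := by rw [hU', hW', Matrix.one_mul, Matrix.mul_one]
    rw [Matrix.mul_sub, Matrix.sub_mul, Matrix.mul_smul, Matrix.smul_mul, this, Matrix.sub_apply,
      Matrix.smul_apply, mul_diagonal, diagonal_mul, smul_eq_mul]
  rw [trace_transpose_mul_conj hU hW]
  simp only [weightedSq]
  rw [hLp (1 / 4), hRp (1 / 4), trace_quad_diagonal, trace_quad_diagonal]
  conv_rhs => rw [hLp, hRp, trace_quad_diagonal]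
  simp only [hent, Finset.mul_sum, ← Finset.sum_sub_distrib, ← Finset.sum_add_distrib]
  exact Finset.sum_congr rfl fun i _ => Finset.sum_congr rfl fun j _ =>
    rpow_quarter_step (ha i) (hb j) (hka i j) (hkb i j)

end OneStep

/-! ### Spectral bounds and trace loss for the sketch. -/

section FrequentDirections

theorem pad_nonneg {v : Fin d → ℝ} (hv : ∀ i, 0 ≤ v i) (j : ℕ) : 0 ≤ pad v j := by
  unfold pad
  split_ifs
  exacts [hv _, le_rfl]

/-- The sketch is obtained by soft-thresholding the eigenvalues at the removed eigenvalue. -/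
theorem IsFDUpdate.exists_threshold {ℓ : ℕ} (hℓ : 1 ≤ ℓ)
    {P M N : Matrix (Fin d) (Fin d) ℝ} {ρ : ℝ}
    (hP : P.PosSemidef) (hM : M.PosSemidef) (h : IsFDUpdate ℓ P M ρ N) :
    ∃ (U : Matrix (Fin d) (Fin d) ℝ) (lam : Fin d → ℝ), U * Uᵀ = 1 ∧ Uᵀ * U = 1 ∧
      (∀ i, 0 ≤ lam i) ∧ 0 ≤ ρ ∧ P + M = U * diagonal lam * Uᵀ ∧
      N = U * diagonal (fun i => max (lam i - ρ) 0) * Uᵀ ∧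
      (∀ i : Fin d, (i : ℕ) < ℓ → ρ ≤ lam i) ∧ (d < ℓ → ρ = 0) := by
  obtain ⟨U, lam, B, hU, hanti, hPM, hρ, hB, hN⟩ := h
  have hU' : Uᵀ * U = 1 := mul_eq_one_comm.mp hU
  have hlam : ∀ i, 0 ≤ lam i := fun i => by
    have := (posSemidef_transpose_conj (hP.add hM) U).diag_nonneg (i := i)
    rwa [hPM, transpose_conj_conj hU', diagonal_apply_eq] at this
  have hbig : d < ℓ → ρ = 0 := fun hd => by
    rw [hρ, pad, dif_neg (by omega)]
  have hlow : ∀ i : Fin d, (i : ℕ) < ℓ → ρ ≤ lam i := fun i hi => by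
    rw [hρ, pad]
    split_ifs with h1
    · exact hanti (Fin.mk_le_mk.2 (by omega : (i : ℕ) ≤ ℓ - 1))
    · exact hlam i
  have hhigh : ∀ i : Fin d, ℓ ≤ (i : ℕ) → lam i ≤ ρ := fun i hi => by
    have h1 : ℓ - 1 < d := by omega
    rw [hρ, pad, dif_pos h1]
    exact hanti (Fin.mk_le_mk.2 (by omega : ℓ - 1 ≤ (i : ℕ)))
  refine ⟨U, lam, hU, hU', hlam, hρ ▸ pad_nonneg hlam _, hPM, ?_, hlow, hbig⟩
  ext i i'
  -- Extension by zero compares the `ℓ` columns of `B` with the `d` eigenvectors. For `ℓ ≤ d` the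
  -- terms with `j ≥ ℓ` are thresholded to zero; for `ℓ ≥ d` the extra columns are padding.
  set g : ℕ → ℝ := fun j => if h : j < d then
    U i ⟨j, h⟩ * U i' ⟨j, h⟩ * max (lam ⟨j, h⟩ - ρ) 0 else 0 with hg
  have h1 : N i i' = ∑ j ∈ Finset.range ℓ, g j := by
    rw [hN, Matrix.mul_apply, ← Fin.sum_univ_eq_sum_range]
    refine Finset.sum_congr rfl fun j _ => ?_
    rw [transpose_apply, hB, hB]
    simp only [hg, pad]
    split_ifs with hj
    · have h0 : 0 ≤ lam ⟨j, hj⟩ - ρ := sub_nonneg.2 (hlow _ j.2)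
      rw [max_eq_left h0]
      calc _ = U i ⟨j, hj⟩ * U i' ⟨j, hj⟩ * Real.sqrt (lam ⟨j, hj⟩ - ρ) ^ 2 := by ring
        _ = _ := by rw [Real.sq_sqrt h0]
    · simp
  have h2 : (U * diagonal (fun i => max (lam i - ρ) 0) * Uᵀ) i i' = ∑ j ∈ Finset.range d, g j := by
    rw [Matrix.mul_apply, ← Fin.sum_univ_eq_sum_range]
    refine Finset.sum_congr rfl fun j _ => ?_
    rw [transpose_apply, mul_diagonal]
    simp only [hg, dif_pos j.2]
    ring
  rw [h1, h2]
  rcases le_total ℓ d with hd | hd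
  · refine Finset.sum_subset (Finset.range_mono hd) fun j hj hj' => ?_
    simp only [Finset.mem_range, not_lt] at hj hj'
    simp only [hg, dif_pos hj]
    rw [max_eq_right (sub_nonpos.2 (hhigh ⟨j, hj⟩ hj')), mul_zero]
  · refine (Finset.sum_subset (Finset.range_mono hd) fun j hj hj' => ?_).symm
    simp only [Finset.mem_range, not_lt] at hj hj'
    simp only [hg, dif_neg hj'.not_gt]

theorem smul_one_eq_conj_diagonal {U : Matrix (Fin d) (Fin d) ℝ} (hU : U * Uᵀ = 1) (c : ℝ) :
    c • (1 : Matrix (Fin d) (Fin d) ℝ) = U * diagonal (fun _ => c) * Uᵀ := by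
  rw [← smul_one_eq_diagonal, Matrix.mul_smul, Matrix.smul_mul, Matrix.mul_one, hU]

/-- Each eigenvalue drops by `min(λ_i, ρ)`, and the `ℓ` leading ones drop by exactly `ρ`, whence the
trace loss `ℓρ`. If `ℓ > d`, then `ρ = 0`. -/
theorem IsFDUpdate.spec {ℓ : ℕ} (hℓ : 1 ≤ ℓ)
    {P M N : Matrix (Fin d) (Fin d) ℝ} {ρ : ℝ}
    (hP : P.PosSemidef) (hM : M.PosSemidef) (h : IsFDUpdate ℓ P M ρ N) :
    0 ≤ ρ ∧ N.PosSemidef ∧ (P + M - N).PosSemidef ∧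
      (N + ρ • (1 : Matrix (Fin d) (Fin d) ℝ) - (P + M)).PosSemidef ∧
      N.trace + ℓ * ρ ≤ (P + M).trace := by
  obtain ⟨U, lam, hU, hU', hlam, hρ, hPM, hN, hlow, hbig⟩ := h.exists_threshold hℓ hP hM
  refine ⟨hρ, ?_, ?_, ?_, ?_⟩
  · rw [hN]
    exact posSemidef_conj_diagonal U fun i => le_max_right _ _
  · rw [hPM, hN, ← Matrix.sub_mul, ← Matrix.mul_sub, diagonal_sub]
    exact posSemidef_conj_diagonal U fun i =>
      sub_nonneg.2 (max_le (by linarith) (hlam i))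
  · rw [hPM, hN, smul_one_eq_conj_diagonal hU, ← Matrix.add_mul, ← Matrix.mul_add, diagonal_add,
      ← Matrix.sub_mul, ← Matrix.mul_sub, diagonal_sub]
    refine posSemidef_conj_diagonal U fun i => ?_
    linarith [le_max_left (lam i - ρ) 0]
  · rw [hPM, hN, trace_conj_diagonal hU', trace_conj_diagonal hU']
    have hcount : (ℓ : ℝ) * ρ ≤ ∑ i : Fin d, if (i : ℕ) < ℓ then ρ else 0 := by
      rcases lt_or_ge d ℓ with hd | hd
      · simp [hbig hd]
      · rw [Fin.sum_univ_eq_sum_range (fun i => if i < ℓ then ρ else 0) d,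
          ← Finset.sum_subset (Finset.range_mono hd) fun j _ hj => by
            simp only [Finset.mem_range] at hj; simp [hj]]
        rw [Finset.sum_congr rfl fun j hj => if_pos (Finset.mem_range.1 hj)]
        simp
    have hsum : ∑ i, max (lam i - ρ) 0 + ∑ i : Fin d, (if (i : ℕ) < ℓ then ρ else 0) ≤
        ∑ i, lam i := by
      rw [← Finset.sum_add_distrib]
      refine Finset.sum_le_sum fun i _ => ?_
      split_ifs with hi
      · rw [max_eq_left (sub_nonneg.2 (hlow i hi))]; linarith
      · rw [add_zero]; exact max_le (by linarith) (hlam i)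
    linarith

theorem cumMass_succ (ρ : ℕ → ℝ) (t : ℕ) : cumMass ρ (t + 1) = cumMass ρ t + ρ (t + 1) :=
  Finset.sum_Icc_succ_top (by omega) _

/-- The sketch of the sum of `M 1, …, M T` is a two-sided approximation of that sum, and the escaped
mass is paid for by a loss of trace. -/
theorem frequentDirections_spec {ℓ T : ℕ} (hℓ : 1 ≤ ℓ) {S M : ℕ → Matrix (Fin d) (Fin d) ℝ}
    {ρ : ℕ → ℝ} (hS : S 0 = 0) (hM : ∀ t, (M t).PosSemidef)
    (h : ∀ t ∈ Finset.Icc 1 T, IsFDUpdate ℓ (S (t - 1)) (M t) (ρ t) (S t)) :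
    ∀ t ≤ T, 0 ≤ cumMass ρ t ∧ (S t).PosSemidef ∧
      (∑ s ∈ Finset.Icc 1 t, M s - S t).PosSemidef ∧
      (S t + cumMass ρ t • (1 : Matrix (Fin d) (Fin d) ℝ) -
        ∑ s ∈ Finset.Icc 1 t, M s).PosSemidef ∧
      (S t).trace + ℓ * cumMass ρ t ≤ (∑ s ∈ Finset.Icc 1 t, M s).trace := by
  intro t
  induction t with
  | zero => simp [cumMass, hS, PosSemidef.zero]
  | succ t ih =>
    intro ht
    obtain ⟨i1, i2, i3, i4, i5⟩ := ih (by omega)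
    have hup := h (t + 1) (Finset.mem_Icc.2 ⟨by omega, ht⟩)
    rw [Nat.add_sub_cancel] at hup
    obtain ⟨j1, j2, j3, j4, j5⟩ := hup.spec hℓ i2 (hM _)
    rw [cumMass_succ, Finset.sum_Icc_succ_top (by omega)]
    refine ⟨add_nonneg i1 j1, j2, ?_, ?_, ?_⟩
    · convert i3.add j3 using 1
      abel
    · convert i4.add j4 using 1
      rw [add_smul]
      abel
    · rw [trace_add] at j5 ⊢
      linarith

theorem posSemidef_precond {δ : ℝ} (hδ : 0 ≤ δ) {S : ℕ → Matrix (Fin d) (Fin d) ℝ} {ρ : ℕ → ℝ}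
    {t : ℕ} (hS : (S t).PosSemidef) (hρ : 0 ≤ cumMass ρ t) : (precond δ S ρ t).PosSemidef :=
  hS.add (PosSemidef.one.smul (add_nonneg hρ hδ))

/-- The added `ρ` offsets the largest possible drop of an eigenvalue, so the preconditioner grows by
at least `M`. -/
theorem posSemidef_precond_succ_sub {ℓ : ℕ} (hℓ : 1 ≤ ℓ) (δ : ℝ)
    {S : ℕ → Matrix (Fin d) (Fin d) ℝ} {M : Matrix (Fin d) (Fin d) ℝ} {ρ : ℕ → ℝ} {t : ℕ}
    (hS : (S t).PosSemidef) (hM : M.PosSemidef)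
    (h : IsFDUpdate ℓ (S t) M (ρ (t + 1)) (S (t + 1))) :
    (precond δ S ρ (t + 1) - (precond δ S ρ t + M)).PosSemidef := by
  obtain ⟨-, -, -, h4, -⟩ := h.spec hℓ hS hM
  convert h4 using 1
  simp only [precond, cumMass_succ, add_smul]
  abel

end FrequentDirections

/-! ### Escaped mass against the spectral tail. -/

section Omega

theorem exists_perm_eig {A : Matrix (Fin d) (Fin d) ℝ} (hA : A.IsHermitian) :
    ∃ σ : Equiv.Perm (Fin d), ∀ i, hA.eigenvalues i = eig A ((σ i : ℕ) + 1) := by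
  refine ⟨(Fintype.equivOfCardEq (Fintype.card_fin _)).symm.trans
    (finCongr (Fintype.card_fin d)), fun i => ?_⟩
  rw [eig, dif_pos hA, dif_pos ⟨by omega, by omega⟩]
  rfl

theorem sum_Icc_succ_eq_sum_fin (g : ℕ → ℝ) (k : ℕ) :
    ∑ i ∈ Finset.Icc (k + 1) d, g i = ∑ j : Fin d, if k ≤ (j : ℕ) then g (j + 1) else 0 := by
  rw [Fin.sum_univ_eq_sum_range (fun j => if k ≤ j then g (j + 1) else 0) d, ← Finset.sum_filter]
  refine Finset.sum_bij' (fun i _ => i - 1) (fun j _ => j + 1) ?_ ?_ ?_ ?_ ?_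
  all_goals intro i hi; simp only [Finset.mem_Icc, Finset.mem_filter, Finset.mem_range] at hi ⊢
  all_goals first | omega | skip
  rw [Nat.sub_add_cancel (by omega)]

/-- In an eigenbasis of `A`, bound the `k` leading eigenvalues by the diagonal of `S` plus `ρ` and
keep the others. This gives `tr A ≤ tr S + kρ + tail`; compare with `tr S + ℓρ ≤ tr A`. -/
theorem sum_eig_tail_ge {A S : Matrix (Fin d) (Fin d) ℝ} {ρ : ℝ} {ℓ : ℕ} (hA : A.PosSemidef)
    (hS : S.PosSemidef) (hρ : 0 ≤ ρ)
    (hle : (S + ρ • (1 : Matrix (Fin d) (Fin d) ℝ) - A).PosSemidef)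
    (htr : S.trace + ℓ * ρ ≤ A.trace) (k : ℕ) :
    ρ * ((ℓ : ℝ) - k) ≤ ∑ i ∈ Finset.Icc (k + 1) d, eig A i := by
  obtain ⟨U, hU, hU', hAU, -⟩ := exists_spectral hA.isHermitian
  obtain ⟨σ, hσ⟩ := exists_perm_eig hA.isHermitian
  set a := hA.isHermitian.eigenvalues
  have htail : ∑ i ∈ Finset.Icc (k + 1) d, eig A i = ∑ i, if k ≤ (σ i : ℕ) then a i else 0 := by
    rw [sum_Icc_succ_eq_sum_fin, ← Equiv.sum_comp σ]
    simp only [hσ]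
  have hcount : ∑ i, (if k ≤ (σ i : ℕ) then 0 else ρ) ≤ k * ρ := by
    rw [Equiv.sum_comp σ (fun j => if k ≤ (j : ℕ) then 0 else ρ),
      Fin.sum_univ_eq_sum_range (fun j => if k ≤ j then 0 else ρ) d]
    -- The maximum covers `k > d`.
    calc _ ≤ ∑ j ∈ Finset.range (max d k), (if k ≤ j then 0 else ρ) :=
          Finset.sum_le_sum_of_subset_of_nonneg (Finset.range_mono (le_max_left _ _))
            fun j _ _ => by split_ifs <;> [exact le_rfl; exact hρ]
      _ = ∑ j ∈ Finset.range k, (if k ≤ j then 0 else ρ) :=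
          (Finset.sum_subset (Finset.range_mono (le_max_right _ _)) fun j _ hj =>
            if_pos (by simpa using hj)).symm
      _ = ∑ j ∈ Finset.range k, ρ :=
          Finset.sum_congr rfl fun j hj => if_neg (by simpa using hj)
      _ = k * ρ := by simp
  have hdiag : ∀ i, a i ≤ (Uᵀ * S * U) i i + ρ := fun i => by
    have := diag_conj_le hle U i
    rw [hAU, transpose_conj_conj hU', diagonal_apply_eq, Matrix.mul_add, Matrix.add_mul,
      Matrix.add_apply, Matrix.mul_smul, Matrix.smul_mul, Matrix.mul_one, hU'] at this
    simpa using this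
  have htrA : A.trace = ∑ i, a i := by
    conv_lhs => rw [hAU, trace_conj_diagonal hU']
  have hsum : ∑ i, a i ≤ ∑ i, (Uᵀ * S * U) i i + (∑ i, if k ≤ (σ i : ℕ) then 0 else ρ) +
      ∑ i, if k ≤ (σ i : ℕ) then a i else 0 := by
    rw [← Finset.sum_add_distrib, ← Finset.sum_add_distrib]
    refine Finset.sum_le_sum fun i _ => ?_
    have h0 := (posSemidef_transpose_conj hS U).diag_nonneg (i := i)
    have h1 := hdiag i
    split_ifs <;> linarith
  have htrS : ∑ i, (Uᵀ * S * U) i i = S.trace := trace_transpose_conj hU S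
  rw [htail]
  linarith

theorem le_Omega {A S : Matrix (Fin d) (Fin d) ℝ} {ρ : ℝ} {ℓ : ℕ} (hℓ : 1 ≤ ℓ)
    (hA : A.PosSemidef) (hS : S.PosSemidef) (hρ : 0 ≤ ρ)
    (hle : (S + ρ • (1 : Matrix (Fin d) (Fin d) ℝ) - A).PosSemidef)
    (htr : S.trace + ℓ * ρ ≤ A.trace) : ρ ≤ Omega ℓ A := by
  have : Nonempty (Fin ℓ) := ⟨⟨0, hℓ⟩⟩
  refine le_ciInf fun k => ?_
  have hk : ((k : ℕ) : ℝ) < ℓ := by exact_mod_cast k.2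
  rw [le_div_iff₀ (sub_pos.2 hk)]
  exact sum_eig_tail_ge hA hS hρ hle htr k

theorem Omega_le {ℓ : ℕ} (hℓ : 1 ≤ ℓ) (A : Matrix (Fin d) (Fin d) ℝ) :
    Omega ℓ A ≤ ∑ i ∈ Finset.Icc ℓ d, eig A i := by
  -- The choice `k = ℓ - 1` has denominator `1`.
  refine (ciInf_le (Set.finite_range _).bddBelow ⟨ℓ - 1, by omega⟩).trans_eq ?_
  simp only [Nat.sub_add_cancel hℓ]
  rw [Nat.cast_sub hℓ]
  simp

end Omega

/-! ### Telescoping, the final traces and the step size. -/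

section Regret

theorem trace_mono {A B : Matrix (Fin d) (Fin d) ℝ} (h : (B - A).PosSemidef) :
    A.trace ≤ B.trace := by
  have := h.trace_nonneg
  rw [trace_sub] at this
  linarith

theorem trace_matPow_quarter_add_smul_le {A : Matrix (Fin d) (Fin d) ℝ} (hA : A.PosSemidef)
    {c : ℝ} (hc : 0 ≤ c) :
    (matPow (A + c • (1 : Matrix (Fin d) (Fin d) ℝ)) (1 / 4)).trace ≤
      (matPow A (1 / 4)).trace + d * c ^ (1 / 4 : ℝ) := by
  obtain ⟨U, -, hU', -, h⟩ := exists_spectral hA.isHermitian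
  have h0 := h (fun x => x ^ (1 / 4 : ℝ)) 0
  rw [zero_smul, add_zero] at h0
  rw [matPow, matPow, h, h0, trace_conj_diagonal hU', trace_conj_diagonal hU']
  calc ∑ i, (hA.isHermitian.eigenvalues i + c) ^ (1 / 4 : ℝ)
      ≤ ∑ i, ((hA.isHermitian.eigenvalues i + 0) ^ (1 / 4 : ℝ) + c ^ (1 / 4 : ℝ)) :=
        Finset.sum_le_sum fun i _ => by
          rw [add_zero]
          exact Real.rpow_add_le_add_rpow (hA.eigenvalues_nonneg i) hc (by norm_num) (by norm_num)
    _ = _ := by rw [Finset.sum_add_distrib]; simp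

/-- From `S_t ⪯ A` and `δ ≤ ε`, the preconditioner is at most `(A + εI) + ρ_{1:t} I`; the fourth
root then splits off the last term at the cost `d ρ_{1:t}^{1/4}`. -/
theorem trace_matPow_quarter_precond_le {δ ε ω : ℝ} (hδ : 0 ≤ δ) (hδε : δ ≤ ε)
    {S : ℕ → Matrix (Fin d) (Fin d) ℝ} {A : Matrix (Fin d) (Fin d) ℝ} {ρ : ℕ → ℝ} {t : ℕ}
    (hA : A.PosSemidef) (hS : (S t).PosSemidef) (hρ : 0 ≤ cumMass ρ t)
    (hSA : (A - S t).PosSemidef) (hω : cumMass ρ t ≤ ω) :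
    (matPow (precond δ S ρ t) (1 / 4)).trace ≤
      (matPow (A + ε • (1 : Matrix (Fin d) (Fin d) ℝ)) (1 / 4)).trace +
        d * ω ^ (1 / 4 : ℝ) := by
  have hAε : (A + ε • (1 : Matrix (Fin d) (Fin d) ℝ)).PosSemidef :=
    hA.add (PosSemidef.one.smul (hδ.trans hδε))
  have hsub : (A + ε • (1 : Matrix (Fin d) (Fin d) ℝ) + cumMass ρ t • 1 -
      precond δ S ρ t).PosSemidef := by
    convert hSA.add ((PosSemidef.one (n := Fin d) (R := ℝ)).smul (sub_nonneg.2 hδε)) using 1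
    simp only [precond, add_smul, sub_smul]
    abel
  calc _ ≤ (matPow (A + ε • (1 : Matrix (Fin d) (Fin d) ℝ) + cumMass ρ t • 1) (1 / 4)).trace :=
        trace_mono (posSemidef_matPow_quarter_sub (posSemidef_precond hδ hS hρ)
          (hAε.add (PosSemidef.one.smul hρ)) hsub)
    _ ≤ (matPow (A + ε • (1 : Matrix (Fin d) (Fin d) ℝ)) (1 / 4)).trace +
        d * cumMass ρ t ^ (1 / 4 : ℝ) := trace_matPow_quarter_add_smul_le hAε hρ
    _ ≤ _ := by gcongr

/-- The trace of the Kronecker product of two fourth roots. -/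
noncomputable def quarterTrace (L : Matrix (Fin m) (Fin m) ℝ) (R : Matrix (Fin n) (Fin n) ℝ) : ℝ :=
  (matPow L (1 / 4)).trace * (matPow R (1 / 4)).trace

/-- Online mirror descent with the matrix preconditioners `L t`, `R t`: the linearized regret is
bounded by the trace of the Kronecker product of their fourth roots. -/
theorem linearized_regret_le {T : ℕ} {η D : ℝ} {X G : ℕ → Matrix (Fin m) (Fin n) ℝ}
    {L : ℕ → Matrix (Fin m) (Fin m) ℝ} {R : ℕ → Matrix (Fin n) (Fin n) ℝ}
    {Z : Matrix (Fin m) (Fin n) ℝ}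
    (hL : ∀ t ≤ T, (L t).PosSemidef) (hR : ∀ t ≤ T, (R t).PosSemidef)
    (hLL : ∀ t < T, (L (t + 1) - (L t + G (t + 1) * (G (t + 1))ᵀ)).PosSemidef)
    (hRR : ∀ t < T, (R (t + 1) - (R t + (G (t + 1))ᵀ * G (t + 1))).PosSemidef)
    (hstep : ∀ t ∈ Finset.Icc 1 T, X (t + 1) = X t - η •
      (matPow (L t) (-1 / 4) * G t * matPow (R t) (-1 / 4)))
    (hD : ∀ t ∈ Finset.Icc 1 T, frobNorm (X t - Z) ≤ D) (hT : 1 ≤ T) :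
    2 * η * ∑ t ∈ Finset.Icc 1 T, ((G t)ᵀ * (X t - Z)).trace ≤
      (D ^ 2 + 2 * η ^ 2) * quarterTrace (L T) (R T) := by
  have hq : ∀ t ≤ T, 0 ≤ quarterTrace (L t) (R t) := fun t ht =>
    mul_nonneg (posSemidef_matPow (hL t ht) _).trace_nonneg
      (posSemidef_matPow (hR t ht) _).trace_nonneg
  have hsq : ∀ t ∈ Finset.Icc 1 T, frobNorm (X t - Z) ^ 2 ≤ D ^ 2 := fun t ht =>
    pow_le_pow_left₀ (frobNorm_nonneg _) (hD t ht) 2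
  -- The induction retains the distance to `Z` after the step, in the norm of round `t`. At `t = 0`
  -- the term `D² τ_0` pays for the initial distance.
  have key : ∀ t ≤ T, 2 * η * ∑ s ∈ Finset.Icc 1 t, ((G s)ᵀ * (X s - Z)).trace ≤
      (D ^ 2 + 2 * η ^ 2) * quarterTrace (L t) (R t) -
        weightedSq (matPow (L t) (1 / 4)) (matPow (R t) (1 / 4)) (X (t + 1) - Z) := by
    intro t
    induction t with
    | zero =>
      intro _
      have h1 := weightedSq_le (posSemidef_matPow (hL 0 T.zero_le) (1 / 4))
        (posSemidef_matPow (hR 0 T.zero_le) (1 / 4)) (X 1 - Z)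
      have h2 := mul_le_mul_of_nonneg_right (hsq 1 (Finset.mem_Icc.2 ⟨le_rfl, hT⟩))
        (hq 0 T.zero_le)
      have h3 := mul_nonneg (sq_nonneg η) (hq 0 T.zero_le)
      simp only [Finset.Icc_eq_empty_of_lt zero_lt_one, Finset.sum_empty, mul_zero, zero_add]
      rw [← quarterTrace] at h1
      linarith
    | succ t ih =>
      intro ht
      have ih := ih (by omega)
      have hmem : t + 1 ∈ Finset.Icc 1 T := Finset.mem_Icc.2 ⟨by omega, ht⟩
      have hLt := hL t (by omega)
      have hRt := hR t (by omega)
      have hL1 := hL (t + 1) ht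
      have hR1 := hR (t + 1) ht
      have hGG := posSemidef_mul_transpose_self (G (t + 1))
      have hGG' := posSemidef_transpose_mul_self (G (t + 1))
      have dL : (L (t + 1) - L t).PosSemidef := by
        convert (hLL t ht).add hGG using 1; abel
      have dR : (R (t + 1) - R t).PosSemidef := by
        convert (hRR t ht).add hGG' using 1; abel
      have eL : (L (t + 1) - G (t + 1) * (G (t + 1))ᵀ).PosSemidef := by
        convert (hLL t ht).add hLt using 1; abel
      have eR : (R (t + 1) - (G (t + 1))ᵀ * G (t + 1)).PosSemidef := by
        convert (hRR t ht).add hRt using 1; abel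
      have h1 := weightedSq_step hL1 hR1 eL eR (X (t + 1) - Z) η
      rw [sub_right_comm, ← hstep _ hmem] at h1
      have h2 := weightedSq_sub_le (posSemidef_matPow hLt (1 / 4))
        (posSemidef_matPow hR1 (1 / 4)) (posSemidef_matPow_quarter_sub hLt hL1 dL)
        (posSemidef_matPow_quarter_sub hRt hR1 dR) (X (t + 1) - Z)
      have h3 := weightedSq_gradient_le hLt hRt hL1 hR1 (hLL t ht) (hRR t ht)
      rw [← quarterTrace, ← quarterTrace] at h2 h3
      have hmono : 0 ≤ quarterTrace (L (t + 1)) (R (t + 1)) - quarterTrace (L t) (R t) :=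
        sub_nonneg.2 (mul_le_mul
          (trace_mono (posSemidef_matPow_quarter_sub hLt hL1 dL))
          (trace_mono (posSemidef_matPow_quarter_sub hRt hR1 dR))
          (posSemidef_matPow hRt _).trace_nonneg (posSemidef_matPow hL1 _).trace_nonneg)
      have h4 := mul_le_mul_of_nonneg_right (hsq _ hmem) hmono
      have h5 := mul_le_mul_of_nonneg_left h3 (sq_nonneg η)
      rw [Finset.sum_Icc_succ_top (by omega), mul_add]
      linarith
  have := weightedSq_nonneg (posSemidef_matPow (hL T le_rfl) (1 / 4))
    (posSemidef_matPow (hR T le_rfl) (1 / 4)) (X (T + 1) - Z)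
  linarith [key T le_rfl]

theorem le_of_stepSize {D η S τ : ℝ} {r : ℕ} (hr : 1 ≤ r) (hD : 0 < D) (hτ : 0 ≤ τ)
    (hη : η = D / Real.sqrt (2 * (r : ℝ)))
    (h : 2 * η * S ≤ (D ^ 2 + 2 * η ^ 2) * τ) : S ≤ Real.sqrt (2 * (r : ℝ)) * D * τ := by
  have hr' : (1 : ℝ) ≤ r := by exact_mod_cast hr
  set q := Real.sqrt (2 * (r : ℝ)) with hq
  have hq2 : q ^ 2 = 2 * r := Real.sq_sqrt (by positivity)
  have hq0 : 0 < q := Real.sqrt_pos.2 (by positivity)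
  have hη0 : 0 < η := hη ▸ div_pos hD hq0
  have hDη : D = η * q := by rw [hη]; field_simp
  -- With `D = ηq` and `q² = 2r` this reads `(2r + 2)η² ≤ 4rη²`, that is, `r ≥ 1`.
  have h1 : D ^ 2 + 2 * η ^ 2 ≤ 2 * η * (q * D) := by
    rw [hDη]
    nlinarith [mul_nonneg (sq_nonneg η) (sub_nonneg.2 hr')]
  have h2 : 2 * η * S ≤ 2 * η * (q * D * τ) := by
    linarith [mul_le_mul_of_nonneg_right h1 hτ]
  exact le_of_mul_le_mul_left h2 (by positivity)

end Regret

end SketchyShampoo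

open SketchyShampoo in
/-- Convexity enters only through the existence of the subgradients. The rank bound enters only
through the step size: the gradient sum is bounded by `weightedSq_gradient_le` on the diagonal of an
eigenbasis, where no factor `r` is lost, and the bound then holds for every `r ≥ 1`. -/
theorem mainTheorem3 (m n ℓ r T : ℕ) (hℓ : 1 ≤ ℓ) (hr : 1 ≤ r) (hT : 1 ≤ T)
    (ε δ D η : ℝ) (hδ : 0 ≤ δ) (hδε : δ ≤ ε)
    (f : ℕ → Matrix (Fin m) (Fin n) ℝ → ℝ)
    (hf : ∀ t ∈ Finset.Icc 1 T, ConvexOn ℝ Set.univ (f t))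
    (X G : ℕ → Matrix (Fin m) (Fin n) ℝ)
    (Lbar : ℕ → Matrix (Fin m) (Fin m) ℝ) (Rbar : ℕ → Matrix (Fin n) (Fin n) ℝ)
    (ρL ρR : ℕ → ℝ)
    (hrun : SketchyShampoo.IsRun ℓ T η δ f X G Lbar Rbar ρL ρR)
    (hrank : ∀ t ∈ Finset.Icc 1 T, (G t).rank ≤ r)
    (Xstar : Matrix (Fin m) (Fin n) ℝ)
    (hD : ∀ t ∈ Finset.Icc 1 T, SketchyShampoo.frobNorm (X t - Xstar) ≤ D)
    (hη : η = D / Real.sqrt (2 * (r : ℝ))) :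
    SketchyShampoo.cumMass ρL T ≤ SketchyShampoo.Omega ℓ (SketchyShampoo.leftCov T G) ∧
    SketchyShampoo.Omega ℓ (SketchyShampoo.leftCov T G) ≤
      ∑ i ∈ Finset.Icc ℓ m, SketchyShampoo.eig (SketchyShampoo.leftCov T G) i ∧
    SketchyShampoo.cumMass ρR T ≤ SketchyShampoo.Omega ℓ (SketchyShampoo.rightCov T G) ∧
    SketchyShampoo.Omega ℓ (SketchyShampoo.rightCov T G) ≤
      ∑ i ∈ Finset.Icc ℓ n, SketchyShampoo.eig (SketchyShampoo.rightCov T G) i ∧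
    ∑ t ∈ Finset.Icc 1 T, f t (X t) - ∑ t ∈ Finset.Icc 1 T, f t Xstar ≤
      SketchyShampoo.regretBound ℓ r T D ε G ∧
    ((∀ Y, ∑ t ∈ Finset.Icc 1 T, f t Xstar ≤ ∑ t ∈ Finset.Icc 1 T, f t Y) →
      SketchyShampoo.regret T f X ≤ SketchyShampoo.regretBound ℓ r T D ε G) := by
  have hGG : ∀ t, (G t * (G t)ᵀ).PosSemidef := fun t => posSemidef_mul_transpose_self _
  have hGG' : ∀ t, ((G t)ᵀ * G t).PosSemidef := fun t => posSemidef_transpose_mul_self _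
  have hL := frequentDirections_spec hℓ hrun.Lbar_zero hGG hrun.sketch_left
  have hR := frequentDirections_spec hℓ hrun.Rbar_zero hGG' hrun.sketch_right
  have hLcov : (leftCov T G).PosSemidef := Matrix.posSemidef_sum _ fun t _ => hGG t
  have hRcov : (rightCov T G).PosSemidef := Matrix.posSemidef_sum _ fun t _ => hGG' t
  obtain ⟨l1, l2, l3, l4, l5⟩ := hL T le_rfl
  obtain ⟨r1, r2, r3, r4, r5⟩ := hR T le_rfl
  have hΩL : cumMass ρL T ≤ Omega ℓ (leftCov T G) := le_Omega hℓ hLcov l2 l1 l4 l5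
  have hΩR : cumMass ρR T ≤ Omega ℓ (rightCov T G) := le_Omega hℓ hRcov r2 r1 r4 r5
  have hPL : ∀ t ≤ T, (precond δ Lbar ρL t).PosSemidef := fun t ht =>
    posSemidef_precond hδ (hL t ht).2.1 (hL t ht).1
  have hPR : ∀ t ≤ T, (precond δ Rbar ρR t).PosSemidef := fun t ht =>
    posSemidef_precond hδ (hR t ht).2.1 (hR t ht).1
  have htL := trace_matPow_quarter_precond_le hδ hδε hLcov l2 l1 l3 hΩL
  have htR := trace_matPow_quarter_precond_le hδ hδε hRcov r2 r1 r3 hΩR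
  have hτL := (posSemidef_matPow (hPL T le_rfl) (1 / 4)).trace_nonneg
  have hτR := (posSemidef_matPow (hPR T le_rfl) (1 / 4)).trace_nonneg
  have hD0 : 0 ≤ D := (frobNorm_nonneg _).trans (hD 1 (Finset.mem_Icc.2 ⟨le_rfl, hT⟩))
  have hlin : ∑ t ∈ Finset.Icc 1 T, f t (X t) - ∑ t ∈ Finset.Icc 1 T, f t Xstar ≤
      ∑ t ∈ Finset.Icc 1 T, ((G t)ᵀ * (X t - Xstar)).trace := by
    rw [← Finset.sum_sub_distrib]
    refine Finset.sum_le_sum fun t ht => ?_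
    have := hrun.subgradient t ht Xstar
    rw [← neg_sub (X t), Matrix.mul_neg, Matrix.trace_neg] at this
    linarith
  have hregret : ∑ t ∈ Finset.Icc 1 T, ((G t)ᵀ * (X t - Xstar)).trace ≤
      Real.sqrt (2 * (r : ℝ)) * D *
        quarterTrace (precond δ Lbar ρL T) (precond δ Rbar ρR T) := by
    -- If `D = 0`, then `η = 0` and one cannot divide by it, but every `X_t` equals `X*` and the sum
    -- vanishes.
    rcases hD0.eq_or_lt with h0 | hpos
    · rw [← h0] at hD ⊢
      rw [Finset.sum_eq_zero fun t ht => by simp [eq_zero_of_frobNorm_le_zero (hD t ht)]]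
      simp
    · refine le_of_stepSize hr hpos (mul_nonneg hτL hτR) hη ?_
      refine linearized_regret_le hPL hPR (fun t ht => ?_) (fun t ht => ?_) hrun.step hD hT
      · have h := hrun.sketch_left (t + 1) (Finset.mem_Icc.2 ⟨by omega, ht⟩)
        rw [Nat.add_sub_cancel] at h
        exact posSemidef_precond_succ_sub hℓ δ (hL t ht.le).2.1 (hGG _) h
      · have h := hrun.sketch_right (t + 1) (Finset.mem_Icc.2 ⟨by omega, ht⟩)
        rw [Nat.add_sub_cancel] at h
        exact posSemidef_precond_succ_sub hℓ δ (hR t ht.le).2.1 (hGG' _) h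
  have hbound : ∑ t ∈ Finset.Icc 1 T, f t (X t) - ∑ t ∈ Finset.Icc 1 T, f t Xstar ≤
      regretBound ℓ r T D ε G := by
    refine hlin.trans (hregret.trans ?_)
    rw [regretBound, mul_assoc _ (_ + _) (_ + _)]
    exact mul_le_mul_of_nonneg_left (mul_le_mul htL htR hτR (hτL.trans htL)) (by positivity)
  refine ⟨hΩL, Omega_le hℓ _, hΩR, Omega_le hℓ _, hbound, fun hmin => ?_⟩
  rw [regret]
  exact (sub_le_sub_left (le_ciInf hmin) _).trans hbound
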